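/- Let $(\overline M_1,g_1,J_1)$ and $(\overline M_2,g_2,J_2)$ be arbitrary Kähler manifolds, i.e. smooth finite-dimensional Riemannian manifolds, each with a smooth orthogonal almost complex structure $J_i$ ($J_i^2=-I$) that is parallel for the Levi-Civita connection. Let $\overline M=\overline M_1\times\overline M_2$ carry the product metric $g$ with Levi-Civita connection $\overline\nabla$, let $\overline P,\overline Q$ be the projections of $T\overline M=T\overline M_1\oplus T\overline M_2$ onto its two summands, and put $F=\overline P-\overline Q$. Let $\iota\colon M\to\overline M$ be a smooth immersed submanifold; identify $T_xM$ with its image in $T_{\iota(x)}\overline M$ and let $T_x(M)^\perp$ be the orthogonal complement of $T_xM$ in $T_{\iota(x)}\overline M$. For a normal vector $V$ let $sV$ be the normal part of $FV$. For tangent vector fields $X,Y$ of $M$ let the second fundamental form $B(X,Y)$ be the normal part of $\overline\nabla_XY$ ($Y$ being extended locally to $\overline M$). Theorem. Suppose that $M$ is $F$-anti-invariant, that is, $F(T_xM)\subset T_x(M)^\perp$ for all $x\in M$. If moreover $s\equiv 0$, then $M$ is totally geodesic, that is, $B\equiv 0$. -/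

import Mathlib

open Bundle Manifold VectorField Module
open scoped ContDiff Topology

namespace KaehlerProduct

noncomputable section

section LeviCivita

variable {E : Type*} [NormedAddCommGroup E] [NormedSpace ℝ E]
  {H : Type*} [TopologicalSpace H] {I : ModelWithCorners ℝ E H}
  {M : Type*} [TopologicalSpace M] [ChartedSpace H M] [IsManifold I ∞ M]

/-- A smooth Riemannian metric on the manifold `M`. -/
abbrev SmoothMetric (I : ModelWithCorners ℝ E H) (M : Type*) [TopologicalSpace M] [ChartedSpace H M]
    [IsManifold I ∞ M] :=
  ContMDiffRiemannianMetric I ∞ E (fun x : M ↦ TangentSpace I x)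

variable (g : SmoothMetric I M)

theorem SmoothMetric.mdifferentiableAt {X Y : Π x : M, TangentSpace I x} {x : M}
    (hX : MDiffAt (T% X) x) (hY : MDiffAt (T% Y) x) :
    MDiffAt (fun y ↦ g.inner y (X y) (Y y)) x := by
  have h : MDifferentiableAt I (I.prod 𝓘(ℝ))
      (fun y ↦ TotalSpace.mk' ℝ (E := Bundle.Trivial M ℝ) y (g.inner y (X y) (Y y))) x :=
    MDifferentiableAt.clm_bundle_apply₂ (F₁ := E) (F₂ := E)
      (g.contMDiff.mdifferentiableAt (by simp)) hX hY
  simp only [mdifferentiableAt_totalSpace] at h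
  exact h.2

/-- The right-hand side of the Koszul formula: half of
`X⟨Y,Z⟩ + Y⟨Z,X⟩ - Z⟨X,Y⟩ + ⟨[X,Y],Z⟩ - ⟨[Y,Z],X⟩ + ⟨[Z,X],Y⟩`. -/
def SmoothMetric.koszul (X Y Z : Π x : M, TangentSpace I x) (x : M) : ℝ :=
  1 / 2 * (d% (fun y ↦ g.inner y (Y y) (Z y)) x (X x)
    + d% (fun y ↦ g.inner y (Z y) (X y)) x (Y x)
    - d% (fun y ↦ g.inner y (X y) (Y y)) x (Z x)
    + g.inner x (mlieBracket I X Y x) (Z x)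
    - g.inner x (mlieBracket I Y Z x) (X x)
    + g.inner x (mlieBracket I Z X x) (Y x))

theorem SmoothMetric.mvf_smul_left {X Y : Π x : M, TangentSpace I x} {x : M} {f : M → ℝ}
    (hf : MDiffAt f x) (hX : MDiffAt (T% X) x) (hY : MDiffAt (T% Y) x) (v : TangentSpace I x) :
    d% (fun y ↦ g.inner y ((f • X) y) (Y y)) x v
      = d% f x v * g.inner x (X x) (Y x) + f x * d% (fun y ↦ g.inner y (X y) (Y y)) x v := by
  have : (fun y ↦ g.inner y ((f • X) y) (Y y)) = f * (fun y ↦ g.inner y (X y) (Y y)) := by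
    ext y; simp
  rw [this, mvfderiv_mul hf (g.mdifferentiableAt hX hY)]
  simp; ring

theorem SmoothMetric.mvf_smul_right {X Y : Π x : M, TangentSpace I x} {x : M} {f : M → ℝ}
    (hf : MDiffAt f x) (hX : MDiffAt (T% X) x) (hY : MDiffAt (T% Y) x) (v : TangentSpace I x) :
    d% (fun y ↦ g.inner y (X y) ((f • Y) y)) x v
      = d% f x v * g.inner x (X x) (Y x) + f x * d% (fun y ↦ g.inner y (X y) (Y y)) x v := by
  have : (fun y ↦ g.inner y (X y) ((f • Y) y)) = f * (fun y ↦ g.inner y (X y) (Y y)) := by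
    ext y; simp
  rw [this, mvfderiv_mul hf (g.mdifferentiableAt hX hY)]
  simp; ring

theorem SmoothMetric.mvf_add_left {X X' Y : Π x : M, TangentSpace I x} {x : M}
    (hX : MDiffAt (T% X) x) (hX' : MDiffAt (T% X') x) (hY : MDiffAt (T% Y) x)
    (v : TangentSpace I x) :
    d% (fun y ↦ g.inner y ((X + X') y) (Y y)) x v
      = d% (fun y ↦ g.inner y (X y) (Y y)) x v + d% (fun y ↦ g.inner y (X' y) (Y y)) x v := by
  have : (fun y ↦ g.inner y ((X + X') y) (Y y))
      = (fun y ↦ g.inner y (X y) (Y y)) + (fun y ↦ g.inner y (X' y) (Y y)) := by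
    ext y; simp
  rw [this, mvfderiv_add (g.mdifferentiableAt hX hY) (g.mdifferentiableAt hX' hY)]
  simp

theorem SmoothMetric.mvf_add_right {X Y Y' : Π x : M, TangentSpace I x} {x : M}
    (hX : MDiffAt (T% X) x) (hY : MDiffAt (T% Y) x) (hY' : MDiffAt (T% Y') x)
    (v : TangentSpace I x) :
    d% (fun y ↦ g.inner y (X y) ((Y + Y') y)) x v
      = d% (fun y ↦ g.inner y (X y) (Y y)) x v + d% (fun y ↦ g.inner y (X y) (Y' y)) x v := by
  have : (fun y ↦ g.inner y (X y) ((Y + Y') y))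
      = (fun y ↦ g.inner y (X y) (Y y)) + (fun y ↦ g.inner y (X y) (Y' y)) := by
    ext y; simp
  rw [this, mvfderiv_add (g.mdifferentiableAt hX hY) (g.mdifferentiableAt hX hY')]
  simp

theorem SmoothMetric.eq_zero_of_inner (x : M) (v : TangentSpace I x) (h : g.inner x v = 0) : v = 0 := by
  by_contra hv
  have := g.pos x v hv
  simp [h] at this

theorem SmoothMetric.ext_inner {x : M} {v w : TangentSpace I x}
    (h : ∀ z, g.inner x v z = g.inner x w z) : v = w := by
  rw [← sub_eq_zero]
  apply g.eq_zero_of_inner x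
  ext z
  simp [h]

theorem SmoothMetric.inner_self_nonneg (x : M) (v : TangentSpace I x) : 0 ≤ g.inner x v v := by
  by_cases h : v = 0
  · rw [h, map_zero]
  · exact (g.pos x v h).le

variable [FiniteDimensional ℝ E]

theorem SmoothMetric.koszul_smul₁ {X Y Z : Π x : M, TangentSpace I x} {x : M} {f : M → ℝ}
    (hf : MDiffAt f x) (hX : MDiffAt (T% X) x) (hY : MDiffAt (T% Y) x) (hZ : MDiffAt (T% Z) x) :
    g.koszul (f • X) Y Z x = f x * g.koszul X Y Z x := by
  simp only [koszul, g.mvf_smul_left hf hX hY, g.mvf_smul_right hf hZ hX]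
  simp only [
    mlieBracket_smul_left hf hX, mlieBracket_smul_right hf hX, Pi.smul_apply', map_add, map_smul,
    _root_.add_apply, _root_.smul_apply, smul_eq_mul]
  rw [g.symm x (Z x) (X x)]
  ring

theorem SmoothMetric.koszul_smul₂ {X Y Z : Π x : M, TangentSpace I x} {x : M} {f : M → ℝ}
    (hf : MDiffAt f x) (hX : MDiffAt (T% X) x) (hY : MDiffAt (T% Y) x) (hZ : MDiffAt (T% Z) x) :
    g.koszul X (f • Y) Z x
      = f x * g.koszul X Y Z x + d% f x (X x) * g.inner x (Y x) (Z x) := by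
  simp only [koszul, g.mvf_smul_left hf hY hZ, g.mvf_smul_right hf hX hY]
  simp only [
    mlieBracket_smul_left hf hY, mlieBracket_smul_right hf hY, Pi.smul_apply', map_add, map_smul,
    _root_.add_apply, _root_.smul_apply, smul_eq_mul]
  rw [g.symm x (X x) (Y x)]
  ring

theorem SmoothMetric.koszul_smul₃ {X Y Z : Π x : M, TangentSpace I x} {x : M} {f : M → ℝ}
    (hf : MDiffAt f x) (hX : MDiffAt (T% X) x) (hY : MDiffAt (T% Y) x) (hZ : MDiffAt (T% Z) x) :
    g.koszul X Y (f • Z) x = f x * g.koszul X Y Z x := by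
  simp only [koszul, g.mvf_smul_left hf hZ hX, g.mvf_smul_right hf hY hZ]
  simp only [
    mlieBracket_smul_left hf hZ, mlieBracket_smul_right hf hZ, Pi.smul_apply', map_add, map_smul,
    _root_.add_apply, _root_.smul_apply, smul_eq_mul]
  rw [g.symm x (Z x) (X x), g.symm x (Z x) (Y x)]
  ring

theorem SmoothMetric.koszul_add₁ {X X' Y Z : Π x : M, TangentSpace I x} {x : M}
    (hX : MDiffAt (T% X) x) (hX' : MDiffAt (T% X') x) (hY : MDiffAt (T% Y) x)
    (hZ : MDiffAt (T% Z) x) :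
    g.koszul (X + X') Y Z x = g.koszul X Y Z x + g.koszul X' Y Z x := by
  simp only [koszul, g.mvf_add_left hX hX' hY, g.mvf_add_right hZ hX hX']
  simp only [
    mlieBracket_add_left hX hX', mlieBracket_add_right hX hX', Pi.add_apply, map_add,
    _root_.add_apply]
  ring

theorem SmoothMetric.koszul_add₂ {X Y Y' Z : Π x : M, TangentSpace I x} {x : M}
    (hX : MDiffAt (T% X) x) (hY : MDiffAt (T% Y) x) (hY' : MDiffAt (T% Y') x)
    (hZ : MDiffAt (T% Z) x) :
    g.koszul X (Y + Y') Z x = g.koszul X Y Z x + g.koszul X Y' Z x := by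
  simp only [koszul, g.mvf_add_left hY hY' hZ, g.mvf_add_right hX hY hY']
  simp only [
    mlieBracket_add_left hY hY', mlieBracket_add_right hY hY', Pi.add_apply, map_add,
    _root_.add_apply]
  ring

theorem SmoothMetric.koszul_add₃ {X Y Z Z' : Π x : M, TangentSpace I x} {x : M}
    (hX : MDiffAt (T% X) x) (hY : MDiffAt (T% Y) x) (hZ : MDiffAt (T% Z) x)
    (hZ' : MDiffAt (T% Z') x) :
    g.koszul X Y (Z + Z') x = g.koszul X Y Z x + g.koszul X Y Z' x := by
  simp only [koszul, g.mvf_add_left hZ hZ' hX, g.mvf_add_right hY hZ hZ']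
  simp only [
    mlieBracket_add_left hZ hZ', mlieBracket_add_right hZ hZ', Pi.add_apply, map_add,
    _root_.add_apply]
  ring

/-- The Koszul expression is tensorial in `X` and `Z`, so it is a bilinear form at each point. -/
def SmoothMetric.koszulHom (x : M) (Y : Π x : M, TangentSpace I x) (hY : MDiffAt (T% Y) x) :
    TangentSpace I x →L[ℝ] TangentSpace I x →L[ℝ] ℝ :=
  TensorialAt.mkHom₂ (I := I) (F := E) (F' := E) (fun X Z ↦ g.koszul X Y Z x) x
    (fun _ hZ ↦ ⟨fun hf hX ↦ g.koszul_smul₁ hf hX hY hZ, fun hX hX' ↦ g.koszul_add₁ hX hX' hY hZ⟩)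
    (fun _ hX ↦ ⟨fun hf hZ ↦ g.koszul_smul₃ hf hX hY hZ, fun hZ hZ' ↦ g.koszul_add₃ hX hY hZ hZ'⟩)

theorem SmoothMetric.koszulHom_apply {X Y Z : Π x : M, TangentSpace I x} {x : M}
    (hX : MDiffAt (T% X) x) (hY : MDiffAt (T% Y) x) (hZ : MDiffAt (T% Z) x) :
    g.koszulHom x Y hY (X x) (Z x) = g.koszul X Y Z x :=
  TensorialAt.mkHom₂_apply _ _ hX hZ

instance (x : M) : FiniteDimensional ℝ (TangentSpace I x) :=
  inferInstanceAs (FiniteDimensional ℝ E)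

theorem SmoothMetric.exists_riesz (x : M) (φ : TangentSpace I x →L[ℝ] ℝ) :
    ∃ w : TangentSpace I x, g.inner x w = φ := by
  let L : TangentSpace I x →ₗ[ℝ] Module.Dual ℝ (TangentSpace I x) :=
    (ContinuousLinearMap.coeLM ℝ).comp (g.inner x).toLinearMap
  have hL : Function.Injective L := by
    rw [← LinearMap.ker_eq_bot, LinearMap.ker_eq_bot']
    intro v hv
    apply g.eq_zero_of_inner x v
    ext w
    exact LinearMap.congr_fun hv w
  have hs := (LinearMap.injective_iff_surjective_of_finrank_eq_finrank
    (Subspace.dual_finrank_eq (K := ℝ) (V := TangentSpace I x)).symm).1 hL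
  obtain ⟨w, hw⟩ := hs φ.toLinearMap
  refine ⟨w, ?_⟩
  ext z
  exact LinearMap.congr_fun hw z

/-- The vector representing a linear form with respect to the metric. -/
def SmoothMetric.riesz (x : M) (φ : TangentSpace I x →L[ℝ] ℝ) : TangentSpace I x :=
  (g.exists_riesz x φ).choose

theorem SmoothMetric.inner_riesz (x : M) (φ : TangentSpace I x →L[ℝ] ℝ) (v : TangentSpace I x) :
    g.inner x (g.riesz x φ) v = φ v := by
  rw [riesz, (g.exists_riesz x φ).choose_spec]

open Classical in
/-- `∇ Y` at `x`, determined by `⟨∇_v Y, z⟩ = koszul v Y z` (and `0` where `Y` is not differentiable). -/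
def SmoothMetric.leviCivitaAux (Y : Π x : M, TangentSpace I x) (x : M) :
    TangentSpace I x →L[ℝ] TangentSpace I x :=
  have : T2Space (TangentSpace I x) := inferInstanceAs (T2Space E)
  if hY : MDiffAt (T% Y) x then
    LinearMap.toContinuousLinearMap
      { toFun := fun v ↦ g.riesz x (g.koszulHom x Y hY v)
        map_add' := fun v w ↦ g.ext_inner fun z ↦ by simp [inner_riesz]
        map_smul' := fun c v ↦ g.ext_inner fun z ↦ by simp [inner_riesz] }
  else 0

theorem SmoothMetric.inner_leviCivitaAux {X Y Z : Π x : M, TangentSpace I x} {x : M}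
    (hX : MDiffAt (T% X) x) (hY : MDiffAt (T% Y) x) (hZ : MDiffAt (T% Z) x) :
    g.inner x (g.leviCivitaAux Y x (X x)) (Z x) = g.koszul X Y Z x := by
  rw [leviCivitaAux, dif_pos hY]
  exact (g.inner_riesz x _ _).trans (g.koszulHom_apply hX hY hZ)

/-- The Levi-Civita connection; `g.leviCivita Y x v` is `∇_v Y` at `x`. It is torsion-free and
compatible with the metric by the two facts below. -/
def SmoothMetric.leviCivita : CovariantDerivative I E (fun x : M ↦ TangentSpace I x) where
  toFun := g.leviCivitaAux
  isCovariantDerivativeOnUniv :=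
    { add := by
        intro Y Y' x hY hY' _
        ext1 v
        refine g.ext_inner fun z ↦ ?_
        have hv := FiberBundle.mdifferentiableAt_extend I E v
        have hz := FiberBundle.mdifferentiableAt_extend I E z
        have h := g.inner_leviCivitaAux hv (mdifferentiableAt_add_section hY hY') hz
        have h1 := g.inner_leviCivitaAux hv hY hz
        have h2 := g.inner_leviCivitaAux hv hY' hz
        rw [g.koszul_add₂ hv hY hY' hz, ← h1, ← h2] at h
        simpa using h
      leibniz := by
        intro Y f x hY hf _
        ext1 v
        refine g.ext_inner fun z ↦ ?_
        have hv := FiberBundle.mdifferentiableAt_extend I E v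
        have hz := FiberBundle.mdifferentiableAt_extend I E z
        have h := g.inner_leviCivitaAux hv (hf.smul_section hY) hz
        have h1 := g.inner_leviCivitaAux hv hY hz
        have h2 := g.koszul_smul₂ hf hv hY hz
        rw [← h1] at h2
        have h3 := h.trans h2
        simpa using h3 }

theorem SmoothMetric.inner_leviCivita {X Y Z : Π x : M, TangentSpace I x} {x : M}
    (hX : MDiffAt (T% X) x) (hY : MDiffAt (T% Y) x) (hZ : MDiffAt (T% Z) x) :
    g.inner x (g.leviCivita Y x (X x)) (Z x) = g.koszul X Y Z x :=
  g.inner_leviCivitaAux hX hY hZ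

theorem SmoothMetric.leviCivita_torsion_free {X Y : Π x : M, TangentSpace I x} {x : M}
    (hX : MDiffAt (T% X) x) (hY : MDiffAt (T% Y) x) :
    g.leviCivita Y x (X x) - g.leviCivita X x (Y x) = mlieBracket I X Y x := by
  refine g.ext_inner fun z ↦ ?_
  have hz := FiberBundle.mdifferentiableAt_extend I E z
  have h1 := g.inner_leviCivita hX hY hz
  have h2 := g.inner_leviCivita hY hX hz
  rw [FiberBundle.extend_apply_self] at h1 h2
  rw [map_sub, _root_.sub_apply, h1, h2]
  simp only [koszul, mlieBracket_swap_apply (V := Y) (W := X), map_neg, _root_.neg_apply,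
    mlieBracket_swap_apply (V := X) (W := FiberBundle.extend E z),
    mlieBracket_swap_apply (V := FiberBundle.extend E z) (W := Y),
    FiberBundle.extend_apply_self]
  simp only [fun y ↦ g.symm y (Y y) (X y), fun y ↦ g.symm y (Y y) (FiberBundle.extend E z y),
    fun y ↦ g.symm y (X y) (FiberBundle.extend E z y)]
  ring

theorem SmoothMetric.leviCivita_metric {X Y Z : Π x : M, TangentSpace I x} {x : M}
    (hX : MDiffAt (T% X) x) (hY : MDiffAt (T% Y) x) (hZ : MDiffAt (T% Z) x) :
    d% (fun y ↦ g.inner y (Y y) (Z y)) x (X x)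
      = g.inner x (g.leviCivita Y x (X x)) (Z x) + g.inner x (Y x) (g.leviCivita Z x (X x)) := by
  rw [g.symm x (Y x), g.inner_leviCivita hX hY hZ, g.inner_leviCivita hX hZ hY]
  simp only [koszul, mlieBracket_swap_apply (V := Y) (W := X), map_neg, _root_.neg_apply,
    mlieBracket_swap_apply (V := Z) (W := X),
    mlieBracket_swap_apply (V := Z) (W := Y)]
  simp only [fun y ↦ g.symm y (Y y) (X y), fun y ↦ g.symm y (Z y) (Y y),
    fun y ↦ g.symm y (Z y) (X y)]
  ring

end LeviCivita

section Product

variable {E : Type*} [NormedAddCommGroup E] [NormedSpace ℝ E]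
  {H : Type*} [TopologicalSpace H] {I : ModelWithCorners ℝ E H}
  {M : Type*} [TopologicalSpace M] [ChartedSpace H M] [IsManifold I ∞ M]
  {E' : Type*} [NormedAddCommGroup E'] [NormedSpace ℝ E']
  {H' : Type*} [TopologicalSpace H'] {I' : ModelWithCorners ℝ E' H'}
  {N : Type*} [TopologicalSpace N] [ChartedSpace H' N] [IsManifold I' ∞ N]

theorem SmoothMetric.contMDiff_pullback (g : SmoothMetric I M) {φ : N → M}
    (hφ : ContMDiff I' I ∞ φ) :
    ContMDiff I' (I'.prod 𝓘(ℝ, E' →L[ℝ] E' →L[ℝ] ℝ)) ∞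
      (fun y ↦ TotalSpace.mk' (E' →L[ℝ] E' →L[ℝ] ℝ)
        (E := fun y : N ↦ TangentSpace I' y →L[ℝ] TangentSpace I' y →L[ℝ] ℝ) y
        (((mfderiv I' I φ y).precomp ℝ).comp ((g.inner (φ y)).comp (mfderiv I' I φ y)))) := by
  intro y₀
  rw [contMDiffAt_hom_bundle]
  refine ⟨contMDiffAt_id, ?_⟩
  have hg := (contMDiffAt_hom_bundle _).1 (g.contMDiff (φ y₀))
  have hG := hg.2.comp y₀ (hφ y₀)
  have hD : ContMDiffAt I' 𝓘(ℝ, E' →L[ℝ] E) ∞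
      (inTangentCoordinates I' I id φ (mfderiv I' I φ) y₀) y₀ :=
    (hφ y₀).mfderiv_const (m := ∞) (n := ∞) (by simp)
  have hS := (hD.clm_precomp (F₃ := ℝ)).clm_comp (hG.clm_comp hD)
  refine hS.congr_of_eventuallyEq ?_
  have h1 : ∀ᶠ y in 𝓝 y₀, y ∈ (trivializationAt E' (TangentSpace I') y₀).baseSet :=
    (trivializationAt E' (TangentSpace I') y₀).open_baseSet.mem_nhds
      (FiberBundle.mem_baseSet_trivializationAt' y₀)
  have h2 : ∀ᶠ y in 𝓝 y₀, φ y ∈ (trivializationAt E (TangentSpace I) (φ y₀)).baseSet :=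
    (hφ y₀).continuousAt.eventually
      ((trivializationAt E (TangentSpace I) (φ y₀)).open_baseSet.mem_nhds
        (FiberBundle.mem_baseSet_trivializationAt' (φ y₀)))
  filter_upwards [h1, h2] with y hy1 hy2
  ext v w
  rw [inCoordinates_apply_eq₂ hy1 hy1 (Set.mem_univ _)]
  simp only [ContinuousLinearMap.comp_apply, ContinuousLinearMap.precomp_apply, Function.comp]
  rw [inCoordinates_apply_eq₂ hy2 hy2 (Set.mem_univ _)]
  have A (u : TangentSpace I (φ y)) :
      (trivializationAt E (TangentSpace I) (φ y₀)).symm (φ y)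
        ((trivializationAt E (TangentSpace I) (φ y₀)).linearMapAt ℝ (φ y) u) = u := by
    have h := (trivializationAt E (TangentSpace I) (φ y₀)).symmₗ_linearMapAt (R := ℝ) hy2 u
    rwa [Trivialization.symmₗ_apply (R := ℝ) _ hy2] at h
  simp only [inTangentCoordinates, ContinuousLinearMap.inCoordinates,
    ContinuousLinearMap.comp_apply, Trivialization.continuousLinearMapAt_apply, A,
    Trivial.linearMapAt_trivialization, Trivial.fiberBundle_trivializationAt',
    LinearMap.id_coe, id_eq, Trivialization.symmL_apply _ hy1]

/-- The product metric: the orthogonal direct sum of the two metrics. -/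
def SmoothMetric.prod (g₁ : SmoothMetric I M) (g₂ : SmoothMetric I' N) :
    SmoothMetric (I.prod I') (M × N) where
  inner x :=
    (((ContinuousLinearMap.fst ℝ (TangentSpace I x.1) (TangentSpace I' x.2)).precomp ℝ).comp
      ((g₁.inner x.1).comp (ContinuousLinearMap.fst ℝ (TangentSpace I x.1) (TangentSpace I' x.2))))
    + (((ContinuousLinearMap.snd ℝ (TangentSpace I x.1) (TangentSpace I' x.2)).precomp ℝ).comp
      ((g₂.inner x.2).comp (ContinuousLinearMap.snd ℝ (TangentSpace I x.1) (TangentSpace I' x.2))))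
  symm x v w := congrArg₂ (· + ·) (g₁.symm x.1 v.1 w.1) (g₂.symm x.2 v.2 w.2)
  pos x v hv := by
    change 0 < g₁.inner x.1 v.1 v.1 + g₂.inner x.2 v.2 v.2
    have h1 := g₁.inner_self_nonneg x.1 v.1
    have h2 := g₂.inner_self_nonneg x.2 v.2
    by_cases h : v.1 = 0
    · have h' : v.2 ≠ 0 := fun h' ↦ hv (Prod.ext h h')
      linarith [g₂.pos x.2 v.2 h']
    · linarith [g₁.pos x.1 v.1 h]
  isVonNBounded x := by
    have h1 : Bornology.IsVonNBounded ℝ {v : E | g₁.inner x.1 v v < 1} := g₁.isVonNBounded x.1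
    have h2 : Bornology.IsVonNBounded ℝ {v : E' | g₂.inner x.2 v v < 1} := g₂.isVonNBounded x.2
    rw [NormedSpace.isVonNBounded_iff] at h1 h2
    have h3 : Bornology.IsVonNBounded ℝ
        {v : E × E' | g₁.inner x.1 v.1 v.1 + g₂.inner x.2 v.2 v.2 < 1} := by
      rw [NormedSpace.isVonNBounded_iff]
      refine (h1.prod h2).subset ?_
      rintro ⟨a, b⟩ hab
      have ha := g₁.inner_self_nonneg x.1 a
      have hb := g₂.inner_self_nonneg x.2 b
      simp only [Set.mem_ofPred_eq] at hab
      constructor <;> simp only [Set.mem_ofPred_eq] <;> linarith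
    exact h3
  contMDiff := by
    have h := (g₁.contMDiff_pullback (contMDiff_fst (I := I) (J := I') (M := M) (N := N))).add_section
      (g₂.contMDiff_pullback (contMDiff_snd (I := I) (J := I') (M := M) (N := N)))
    simp only [mfderiv_fst, mfderiv_snd] at h
    exact h

theorem SmoothMetric.prod_inner (g₁ : SmoothMetric I M) (g₂ : SmoothMetric I' N) (x : M × N)
    (v w : TangentSpace (I.prod I') x) :
    (g₁.prod g₂).inner x v w = g₁.inner x.1 v.1 w.1 + g₂.inner x.2 v.2 w.2 := rfl

end Product

section Kaehler

variable (E : Type*) [NormedAddCommGroup E] [NormedSpace ℝ E] [FiniteDimensional ℝ E]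
  (M : Type*) [TopologicalSpace M] [ChartedSpace E M] [IsManifold 𝓘(ℝ, E) ∞ M]

/-- A Kähler structure on the smooth manifold `M`: a Riemannian metric and a smooth almost complex
structure `J` which is orthogonal and parallel for the Levi-Civita connection. -/
structure KaehlerStructure where
  /-- The Riemannian metric. -/
  metric : SmoothMetric 𝓘(ℝ, E) M
  /-- The almost complex structure. -/
  J : ∀ x : M, TangentSpace 𝓘(ℝ, E) x →L[ℝ] TangentSpace 𝓘(ℝ, E) x
  contMDiff_J : ContMDiff 𝓘(ℝ, E) (𝓘(ℝ, E).prod 𝓘(ℝ, E →L[ℝ] E)) ∞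
    (fun x ↦ TotalSpace.mk' (E →L[ℝ] E)
      (E := fun x : M ↦ TangentSpace 𝓘(ℝ, E) x →L[ℝ] TangentSpace 𝓘(ℝ, E) x) x (J x))
  J_J : ∀ x v, J x (J x v) = -v
  inner_J : ∀ x v w, metric.inner x (J x v) (J x w) = metric.inner x v w
  parallel : ∀ (Y : Π x : M, TangentSpace 𝓘(ℝ, E) x) (x : M) (v : TangentSpace 𝓘(ℝ, E) x),
    MDiffAt (T% Y) x →
      metric.leviCivita (fun y ↦ J y (Y y)) x v = J x (metric.leviCivita Y x v)

end Kaehler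

section ProductStructure

variable {E₁ : Type*} [NormedAddCommGroup E₁] [NormedSpace ℝ E₁]
  {H₁ : Type*} [TopologicalSpace H₁] {I₁ : ModelWithCorners ℝ E₁ H₁}
  {M₁ : Type*} [TopologicalSpace M₁] [ChartedSpace H₁ M₁]
  {E₂ : Type*} [NormedAddCommGroup E₂] [NormedSpace ℝ E₂]
  {H₂ : Type*} [TopologicalSpace H₂] {I₂ : ModelWithCorners ℝ E₂ H₂}
  {M₂ : Type*} [TopologicalSpace M₂] [ChartedSpace H₂ M₂]

/-- The projection `(v₁, v₂) ↦ (v₁, 0)` of a tangent space of `M₁ × M₂`. -/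
def projP (x : M₁ × M₂) : TangentSpace (I₁.prod I₂) x →L[ℝ] TangentSpace (I₁.prod I₂) x :=
  (ContinuousLinearMap.inl ℝ (TangentSpace I₁ x.1) (TangentSpace I₂ x.2)).comp
    (ContinuousLinearMap.fst ℝ (TangentSpace I₁ x.1) (TangentSpace I₂ x.2))

/-- The projection `(v₁, v₂) ↦ (0, v₂)` of a tangent space of `M₁ × M₂`. -/
def projQ (x : M₁ × M₂) : TangentSpace (I₁.prod I₂) x →L[ℝ] TangentSpace (I₁.prod I₂) x :=
  (ContinuousLinearMap.inr ℝ (TangentSpace I₁ x.1) (TangentSpace I₂ x.2)).comp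
    (ContinuousLinearMap.snd ℝ (TangentSpace I₁ x.1) (TangentSpace I₂ x.2))

/-- The almost product structure `F = P - Q` of `M₁ × M₂`. -/
def productStructure (x : M₁ × M₂) :
    TangentSpace (I₁.prod I₂) x →L[ℝ] TangentSpace (I₁.prod I₂) x :=
  projP x - projQ x

theorem productStructure_apply (x : M₁ × M₂) (v : TangentSpace (I₁.prod I₂) x) :
    productStructure x v = ((v.1, -v.2) : TangentSpace I₁ x.1 × TangentSpace I₂ x.2) := by
  change ((v.1, 0) : E₁ × E₂) - ((0, v.2) : E₁ × E₂) = _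
  simp
  rfl

end ProductStructure

section Submanifold

variable {E : Type*} [NormedAddCommGroup E] [NormedSpace ℝ E]
  {H : Type*} [TopologicalSpace H] (I : ModelWithCorners ℝ E H)
  {M : Type*} [TopologicalSpace M] [ChartedSpace H M]
  {E' : Type*} [NormedAddCommGroup E'] [NormedSpace ℝ E']
  {H' : Type*} [TopologicalSpace H']

/-- The tangent space of the immersed submanifold `ι : M → N` at `p`, inside that of `N`. -/
def tangentSub (I' : ModelWithCorners ℝ E' H') {N : Type*} [TopologicalSpace N]
    [ChartedSpace H' N] (ι : M → N) (p : M) : Submodule ℝ (TangentSpace I' (ι p)) :=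
  (mfderiv I I' ι p).range

variable {I' : ModelWithCorners ℝ E' H'}
  {N : Type*} [TopologicalSpace N] [ChartedSpace H' N] [IsManifold I' ∞ N]
  (g : SmoothMetric I' N) (ι : M → N) (p : M)

/-- The normal space of the immersed submanifold at `p`. -/
def normalSub : Submodule ℝ (TangentSpace I' (ι p)) where
  carrier := {V | ∀ X ∈ tangentSub I I' ι p, g.inner (ι p) V X = 0}
  add_mem' {V W} hV hW X hX := by
    rw [map_add, _root_.add_apply, hV X hX, hW X hX, add_zero]
  zero_mem' X _ := by rw [map_zero, _root_.zero_apply]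
  smul_mem' c V hV X hX := by rw [map_smul, _root_.smul_apply, hV X hX, smul_zero]

variable [FiniteDimensional ℝ E']

theorem isCompl_tangentSub_normalSub : IsCompl (tangentSub I I' ι p) (normalSub I g ι p) := by
  constructor
  · rw [Submodule.disjoint_def]
    intro v hv hv'
    by_contra h
    exact (g.pos (ι p) v h).ne' (hv' v hv)
  · rw [codisjoint_iff, eq_top_iff]
    intro v _
    let S := tangentSub I I' ι p
    let L : TangentSpace I' (ι p) →ₗ[ℝ] Module.Dual ℝ S :=
      { toFun := fun w ↦ (g.inner (ι p) w).toLinearMap.comp S.subtype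
        map_add' := fun a b ↦ by ext; simp
        map_smul' := fun a b ↦ by ext; simp }
    have hL : Function.Injective (L.comp S.subtype) := by
      rw [← LinearMap.ker_eq_bot, LinearMap.ker_eq_bot']
      intro w hw
      by_contra h
      have h' : (w : TangentSpace I' (ι p)) ≠ 0 := fun h0 ↦ h (Subtype.ext h0)
      exact (g.pos (ι p) w h').ne' (LinearMap.congr_fun hw w)
    have hs := (LinearMap.injective_iff_surjective_of_finrank_eq_finrank
      (Subspace.dual_finrank_eq (K := ℝ) (V := S)).symm).1 hL
    obtain ⟨w, hw⟩ := hs (L v)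
    rw [← add_sub_cancel (w : TangentSpace I' (ι p)) v]
    refine Submodule.add_mem_sup w.2 fun X hX ↦ ?_
    have h := LinearMap.congr_fun hw ⟨X, hX⟩
    have h' : g.inner (ι p) w X = g.inner (ι p) v X := h
    rw [map_sub, _root_.sub_apply, h', sub_self]

/-- The tangential part: the orthogonal projection onto the tangent space of the submanifold. -/
def tangentialPart : TangentSpace I' (ι p) →ₗ[ℝ] TangentSpace I' (ι p) :=
  (tangentSub I I' ι p).projection (normalSub I g ι p) (isCompl_tangentSub_normalSub I g ι p)

/-- The normal part: the orthogonal projection onto the normal space of the submanifold. -/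
def normalPart : TangentSpace I' (ι p) →ₗ[ℝ] TangentSpace I' (ι p) :=
  (normalSub I g ι p).projection (tangentSub I I' ι p) (isCompl_tangentSub_normalSub I g ι p).symm

theorem tangentialPart_add_normalPart (v : TangentSpace I' (ι p)) :
    tangentialPart I g ι p v + normalPart I g ι p v = v :=
  Submodule.projection_add_projection_eq_self (isCompl_tangentSub_normalSub I g ι p) v

/-- A vector field `Y` of `N` defined near `ι p` is an extension of a vector field tangent to the
submanifold near `p`. Only the points of `M` near `p` matter, as `ι` need not be injective. -/
def IsTangentNear (I' : ModelWithCorners ℝ E' H') {N : Type*} [TopologicalSpace N]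
    [ChartedSpace H' N] (ι : M → N) (p : M) (Y : Π y : N, TangentSpace I' y) : Prop :=
  ∀ᶠ q in 𝓝 p, Y (ι q) ∈ tangentSub I I' ι q

/-- The second fundamental form `B(X, Y)` at `p`: the normal part of the ambient covariant
derivative of (an extension `Y` of) a tangent vector field in the tangent direction `X`. -/
def secondFundamentalForm (X : TangentSpace I p) (Y : Π y : N, TangentSpace I' y) :
    TangentSpace I' (ι p) :=
  normalPart I g ι p (g.leviCivita Y (ι p) (mfderiv I I' ι p X))

/-- The submanifold is totally geodesic: its second fundamental form vanishes identically. -/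
def IsTotallyGeodesic : Prop :=
  ∀ (p : M) (X : TangentSpace I p) (Y : Π y : N, TangentSpace I' y),
    CMDiffAt ∞ (T% Y) (ι p) → IsTangentNear I I' ι p Y →
      secondFundamentalForm I g ι p X Y = 0

end Submanifold

section AntiInvariant

variable {E : Type*} [NormedAddCommGroup E] [NormedSpace ℝ E]
  {H : Type*} [TopologicalSpace H] (I : ModelWithCorners ℝ E H)
  {M : Type*} [TopologicalSpace M] [ChartedSpace H M]
  {E₁ : Type*} [NormedAddCommGroup E₁] [NormedSpace ℝ E₁]
  {H₁ : Type*} [TopologicalSpace H₁] {I₁ : ModelWithCorners ℝ E₁ H₁}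
  {M₁ : Type*} [TopologicalSpace M₁] [ChartedSpace H₁ M₁] [IsManifold I₁ ∞ M₁]
  {E₂ : Type*} [NormedAddCommGroup E₂] [NormedSpace ℝ E₂]
  {H₂ : Type*} [TopologicalSpace H₂] {I₂ : ModelWithCorners ℝ E₂ H₂}
  {M₂ : Type*} [TopologicalSpace M₂] [ChartedSpace H₂ M₂] [IsManifold I₂ ∞ M₂]
  (g : SmoothMetric (I₁.prod I₂) (M₁ × M₂)) (ι : M → M₁ × M₂)

/-- The submanifold is `F`-anti-invariant: `F` maps tangent vectors to normal vectors. -/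
def IsFAntiInvariant : Prop :=
  ∀ (p : M), ∀ X ∈ tangentSub I (I₁.prod I₂) ι p, productStructure (ι p) X ∈ normalSub I g ι p

variable [FiniteDimensional ℝ E₁] [FiniteDimensional ℝ E₂]

/-- The operator `s`: for a normal vector `V`, the normal part of `F V`. -/
def sOperator (p : M) : normalSub I g ι p →ₗ[ℝ] TangentSpace (I₁.prod I₂) (ι p) :=
  (normalPart I g ι p).comp
    ((productStructure (ι p)).toLinearMap.comp (normalSub I g ι p).subtype)

end AntiInvariant

end

end KaehlerProduct

namespace KaehlerProduct

/-! ### Coordinate vector fields of a chart and their brackets. -/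

section CoordinateFields

variable {E : Type*} [NormedAddCommGroup E] [NormedSpace ℝ E]
  {H : Type*} [TopologicalSpace H] {I : ModelWithCorners ℝ E H}
  {M : Type*} [TopologicalSpace M] [ChartedSpace H M]

/-! The structure `F` of a Riemannian product is parallel, self-adjoint and an involution. For
tangent fields put `α(X, Y, Z) = ⟨∇_X Y, F Z⟩`. Anti-invariance says `⟨Y, F Z⟩ = 0` along `M`;
differentiating this along `M` and using that `F` is parallel shows that `α` is antisymmetric in `Y,
Z` (`inner_leviCivita_antisymm`). For commuting fields, vanishing torsion makes `α` symmetric in `X,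
Y`. A trilinear-type expression symmetric in its first two slots and antisymmetric in its last two
is zero, so `∇_X Y` has no component in `F(TM)` (`inner_leviCivita_productStructure_eq_zero`).

If `s = 0`, the normal vector `B = B(X, Y)` has tangent image `F B`. Taking `Z = F B` gives `F Z =
B`, hence `0 = ⟨∇_X Y, B⟩ = ⟨B, B⟩`.

Two ingredients need coordinates. Commuting ambient fields tangent to `M` come from the normal form
of an immersion (`exists_adapted_coordinates`). Parallelism of `F` (`leviCivita_productStructure`)
comes from the Koszul formula in a product chart, where `F` has constant coefficients and the metric
coefficients split. -/

theorem isInvertible_mfderiv_extend [IsManifold I ∞ M] [I.Boundaryless]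
    {e : OpenPartialHomeomorph M H}
    (he : e ∈ IsManifold.maximalAtlas I ∞ M) {x : M} (hx : x ∈ e.source) :
    (mfderiv I 𝓘(ℝ, E) (e.extend I) x).IsInvertible := by
  have hxs : x ∈ (e.extend I).source := by rwa [e.extend_source]
  have h1 : MDifferentiableAt I 𝓘(ℝ, E) (e.extend I) x :=
    (e.contMDiffAt_extend he hx).mdifferentiableAt (by simp)
  -- Without boundary this target is open in `E`, so the inverse chart has a full derivative there,
  -- and the two derivatives are mutually inverse by the chain rule.
  have ht : (e.extend I).target ∈ 𝓝 (e.extend I x) :=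
    (e.isOpen_extend_target).mem_nhds ((e.extend I).map_source hxs)
  have h2 : MDifferentiableAt 𝓘(ℝ, E) I (e.extend I).symm (e.extend I x) := by
    have := contMDiffOn_extend_symm he
    rw [← e.extend_target'] at this
    exact (this.contMDiffAt ht).mdifferentiableAt (by simp)
  have hl : (e.extend I).symm (e.extend I x) = x := (e.extend I).left_inv hxs
  have hA : HasMFDerivAt I I ((e.extend I).symm ∘ e.extend I) x
      ((mfderiv 𝓘(ℝ, E) I (e.extend I).symm (e.extend I x)).comp
        (mfderiv I 𝓘(ℝ, E) (e.extend I) x)) :=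
    h2.hasMFDerivAt.comp x h1.hasMFDerivAt
  have hA' : HasMFDerivAt I I ((e.extend I).symm ∘ e.extend I) x
      (ContinuousLinearMap.id ℝ (TangentSpace I x)) := by
    refine (hasMFDerivAt_id x).congr_of_eventuallyEq ?_
    filter_upwards [e.open_source.mem_nhds hx] with y hy
    exact (e.extend I).left_inv (by rwa [e.extend_source])
  have hB : HasMFDerivAt 𝓘(ℝ, E) 𝓘(ℝ, E) (e.extend I ∘ (e.extend I).symm) (e.extend I x)
      ((mfderiv I 𝓘(ℝ, E) (e.extend I) x).comp
        (mfderiv 𝓘(ℝ, E) I (e.extend I).symm (e.extend I x))) :=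
    HasMFDerivAt.comp _ (by rw [hl]; exact h1.hasMFDerivAt) h2.hasMFDerivAt
  have hB' : HasMFDerivAt 𝓘(ℝ, E) 𝓘(ℝ, E) (e.extend I ∘ (e.extend I).symm) (e.extend I x)
      (ContinuousLinearMap.id ℝ (TangentSpace 𝓘(ℝ, E) (e.extend I x))) := by
    refine (hasMFDerivAt_id _).congr_of_eventuallyEq ?_
    filter_upwards [ht] with y hy
    exact (e.extend I).right_inv hy
  exact ContinuousLinearMap.IsInvertible.of_inverse (hasMFDerivAt_unique hB hB')
    (hasMFDerivAt_unique hA hA')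

/-- The constant vector field on a normed space. -/
def constField (v : E) : Π x : E, TangentSpace 𝓘(ℝ, E) x :=
  fun _ ↦ v

/-- The vector field which has constant coordinates `v` in the chart `φ`. -/
noncomputable def coordField (I : ModelWithCorners ℝ E H) (φ : M → E) (v : E) :
    Π x : M, TangentSpace I x :=
  mpullback I 𝓘(ℝ, E) φ (constField v)

variable {φ : M → E} {x : M}

theorem mfderiv_coordField (hi : (mfderiv I 𝓘(ℝ, E) φ x).IsInvertible) (v : E) :
    mfderiv I 𝓘(ℝ, E) φ x (coordField I φ v x) = v :=
  (hi.inverse_apply_eq.1 rfl).symm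

/-- Serves to identify a coordinate field by comparing images in the model space, where everything
is constant. -/
theorem coordField_eq (hi : (mfderiv I 𝓘(ℝ, E) φ x).IsInvertible) {v : E} {w : TangentSpace I x}
    (h : mfderiv I 𝓘(ℝ, E) φ x w = v) : coordField I φ v x = w :=
  hi.inverse_apply_eq.2 h.symm

theorem coordField_neg (φ : M → E) (a : E) (y : M) : coordField I φ (-a) y = -coordField I φ a y :=
  mpullback_neg_apply (V := constField a)

theorem mdifferentiableAt_constField (v y : E) :
    MDiffAt (T% (constField v)) y := by
  rw [mdifferentiableAt_section]
  simpa using! mdifferentiableAt_const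

variable [IsManifold I ∞ M] [FiniteDimensional ℝ E]

theorem mdifferentiableAt_coordField (hφ : CMDiffAt ∞ φ x)
    (hi : (mfderiv I 𝓘(ℝ, E) φ x).IsInvertible) (v : E) :
    MDiffAt (T% (coordField I φ v)) x :=
  MDifferentiableAt.mpullback_vectorField (n := ∞)
    (mdifferentiableAt_constField v (φ x)) hφ hi (by norm_cast)

/-- Pullback commutes with Lie brackets, and constant fields on `E` commute. -/
theorem mlieBracket_coordField (hφ : CMDiffAt ∞ φ x) (v w : E) :
    mlieBracket I (coordField I φ v) (coordField I φ w) x = 0 := by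
  have hI : IsManifold I (minSmoothness ℝ 2) M := by
    rw [minSmoothness_of_isRCLikeNormedField]
    infer_instance
  have := mpullback_mlieBracket (n := ∞) (f := φ) (I := I)
    (mdifferentiableAt_constField v (φ x))
    (mdifferentiableAt_constField w (φ x)) hφ
    (by rw [minSmoothness_of_isRCLikeNormedField]; norm_cast)
  have hc : lieBracketWithin ℝ (fun _ : E ↦ v) (fun _ ↦ w) Set.univ = 0 := by
    ext y
    simp [lieBracketWithin]
  have hz : mlieBracket 𝓘(ℝ, E) (constField v) (constField w) = 0 := by
    rw [← mlieBracketWithin_univ]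
    exact mlieBracketWithin_eq_lieBracketWithin.trans hc
  rw [coordField, coordField, ← this, hz, mpullback_zero]
  rfl

end CoordinateFields

/-! ### The structure `F` in product charts. -/

section ProductCharts

variable {E₁ : Type*} [NormedAddCommGroup E₁] [NormedSpace ℝ E₁]
  {H₁ : Type*} [TopologicalSpace H₁] {I₁ : ModelWithCorners ℝ E₁ H₁}
  {M₁ : Type*} [TopologicalSpace M₁] [ChartedSpace H₁ M₁]
  {E₂ : Type*} [NormedAddCommGroup E₂] [NormedSpace ℝ E₂]
  {H₂ : Type*} [TopologicalSpace H₂] {I₂ : ModelWithCorners ℝ E₂ H₂}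
  {M₂ : Type*} [TopologicalSpace M₂] [ChartedSpace H₂ M₂]

theorem productStructure_productStructure (x : M₁ × M₂) (v : TangentSpace (I₁.prod I₂) x) :
    productStructure x (productStructure x v) = v := by
  rw [productStructure_apply, productStructure_apply]
  exact Prod.ext rfl (neg_neg v.2)

variable [IsManifold I₁ ∞ M₁] [IsManifold I₂ ∞ M₂]

/-- The two summands are orthogonal and `F` acts on them as `1` and `-1`. -/
theorem inner_productStructure (g₁ : SmoothMetric I₁ M₁) (g₂ : SmoothMetric I₂ M₂) (x : M₁ × M₂)
    (v w : TangentSpace (I₁.prod I₂) x) :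
    (g₁.prod g₂).inner x (productStructure x v) w
      = (g₁.prod g₂).inner x v (productStructure x w) := by
  have h₁ (u : TangentSpace (I₁.prod I₂) x) : (productStructure x u).1 = u.1 := by
    have := congrArg (fun u : E₁ × E₂ ↦ u.1) (productStructure_apply x u)
    exact this
  have h₂ (u : TangentSpace (I₁.prod I₂) x) : (productStructure x u).2 = -u.2 :=
    congrArg (fun u : E₁ × E₂ ↦ u.2) (productStructure_apply x u)
  rw [SmoothMetric.prod_inner, SmoothMetric.prod_inner, h₁, h₁, h₂, h₂]
  have h₃ (a b : TangentSpace I₂ x.2) : g₂.inner x.2 (-a) b = g₂.inner x.2 a (-b) := by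
    rw [map_neg, map_neg, _root_.neg_apply]
  exact congrArg (g₁.inner x.1 v.1 w.1 + ·) (h₃ v.2 w.2)

/-- The point `y` ranges over the whole chart domain around `x`, since the coordinate fields built
from this are differentiated at `x`. -/
theorem mfderiv_extChartAt_prod {x y : M₁ × M₂} (h₁ : y.1 ∈ (chartAt H₁ x.1).source)
    (h₂ : y.2 ∈ (chartAt H₂ x.2).source) (v : TangentSpace (I₁.prod I₂) y) :
    mfderiv (I₁.prod I₂) 𝓘(ℝ, E₁ × E₂) (extChartAt (I₁.prod I₂) x) y v
      = ((mfderiv I₁ 𝓘(ℝ, E₁) (extChartAt I₁ x.1) y.1 v.1,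
        mfderiv I₂ 𝓘(ℝ, E₂) (extChartAt I₂ x.2) y.2 v.2) : E₁ × E₂) := by
  have H₁ := (mdifferentiableAt_extChartAt (I := I₁) h₁).hasMFDerivAt.comp y
    (hasMFDerivAt_fst (I := I₁) (I' := I₂) (x := y))
  have H₂ := (mdifferentiableAt_extChartAt (I := I₂) h₂).hasMFDerivAt.comp y
    (hasMFDerivAt_snd (I := I₁) (I' := I₂) (x := y))
  have h : HasMFDerivAt (I₁.prod I₂) 𝓘(ℝ, E₁ × E₂)
      (fun y ↦ (((extChartAt I₁ x.1) ∘ Prod.fst) y, ((extChartAt I₂ x.2) ∘ Prod.snd) y)) y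
      (((mfderiv I₁ 𝓘(ℝ, E₁) (extChartAt I₁ x.1) y.1).comp
        (ContinuousLinearMap.fst ℝ (TangentSpace I₁ y.1) (TangentSpace I₂ y.2))).prod
      ((mfderiv I₂ 𝓘(ℝ, E₂) (extChartAt I₂ x.2) y.2).comp
        (ContinuousLinearMap.snd ℝ (TangentSpace I₁ y.1) (TangentSpace I₂ y.2)))) :=
    ⟨H₁.1.prodMk H₂.1, HasFDerivWithinAt.prodMk H₁.2 H₂.2⟩
  have he : (extChartAt (I₁.prod I₂) x : M₁ × M₂ → E₁ × E₂)
      = fun y ↦ (((extChartAt I₁ x.1) ∘ Prod.fst) y, ((extChartAt I₂ x.2) ∘ Prod.snd) y) := by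
    rw [extChartAt_prod]
    rfl
  rw [he, h.mfderiv]
  rfl

/-- In a product chart `F` is the constant map `(a, b) ↦ (a, -b)`. -/
theorem mfderiv_extChartAt_productStructure {x y : M₁ × M₂}
    (hy : y ∈ (chartAt (ModelProd H₁ H₂) x).source) (v : TangentSpace (I₁.prod I₂) y) :
    mfderiv (I₁.prod I₂) 𝓘(ℝ, E₁ × E₂) (extChartAt (I₁.prod I₂) x) y (productStructure y v)
      = ((mfderiv (I₁.prod I₂) 𝓘(ℝ, E₁ × E₂) (extChartAt (I₁.prod I₂) x) y v : E₁ × E₂).1,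
        -(mfderiv (I₁.prod I₂) 𝓘(ℝ, E₁ × E₂) (extChartAt (I₁.prod I₂) x) y v : E₁ × E₂).2) := by
  have hy' : y.1 ∈ (chartAt H₁ x.1).source ∧ y.2 ∈ (chartAt H₂ x.2).source := by
    simpa using hy
  rw [mfderiv_extChartAt_prod hy'.1 hy'.2, mfderiv_extChartAt_prod hy'.1 hy'.2,
    productStructure_apply]
  exact Prod.ext rfl (map_neg (mfderiv I₂ 𝓘(ℝ, E₂) (extChartAt I₂ x.2) y.2) v.2)

/-- Since `F` is a constant linear map in the trivialization at `x`, composing with it preserves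
differentiability. -/
theorem mdifferentiableAt_productStructure {Y : Π x : M₁ × M₂, TangentSpace (I₁.prod I₂) x}
    {x : M₁ × M₂} (hY : MDiffAt (T% Y) x) :
    MDiffAt (T% (fun y ↦ productStructure y (Y y))) x := by
  rw [mdifferentiableAt_section] at hY ⊢
  have hF : MDifferentiableAt 𝓘(ℝ, E₁ × E₂) 𝓘(ℝ, E₁ × E₂) (fun u : E₁ × E₂ ↦ (u.1, -u.2))
      ((trivializationAt (E₁ × E₂) (TangentSpace (I₁.prod I₂)) x (T% Y x)).2) := by
    apply DifferentiableAt.mdifferentiableAt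
    fun_prop
  refine (hF.comp x hY).congr_of_eventuallyEq ?_
  filter_upwards [(chartAt (ModelProd H₁ H₂) x).open_source.mem_nhds
    (mem_chart_source (ModelProd H₁ H₂) x)] with y hy
  -- The trivialization of the tangent bundle at `x` is the derivative of the chart at `x`.
  have key (v : TangentSpace (I₁.prod I₂) y) :
      (trivializationAt (E₁ × E₂) (TangentSpace (I₁.prod I₂)) x
        (TotalSpace.mk' (E₁ × E₂) y v)).2
      = mfderiv (I₁.prod I₂) 𝓘(ℝ, E₁ × E₂) (extChartAt (I₁.prod I₂) x) y v := by
    have hy' : y ∈ (trivializationAt (E₁ × E₂) (TangentSpace (I₁.prod I₂)) x).baseSet := by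
      simpa using hy
    have h := congrArg (fun L ↦ L v)
      (TangentBundle.continuousLinearMapAt_trivializationAt (I := I₁.prod I₂) hy)
    refine Eq.trans ?_ h
    change _ =
      (trivializationAt (E₁ × E₂) (TangentSpace (I₁.prod I₂)) x).continuousLinearMapAt ℝ y v
    rw [Trivialization.continuousLinearMapAt_apply, Trivialization.linearMapAt_apply, if_pos hy']
  refine (key _).trans ?_
  rw [mfderiv_extChartAt_productStructure hy]
  simp only [Function.comp_apply, key]

/-- The coordinate vector fields of a product chart are sums of coordinate vector fields of the
two factors. -/
theorem coordField_prod {x y : M₁ × M₂} (hy : y ∈ (chartAt (ModelProd H₁ H₂) x).source)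
    (v : E₁ × E₂) :
    coordField (I₁.prod I₂) (extChartAt (I₁.prod I₂) x) v y
      = ((coordField I₁ (extChartAt I₁ x.1) v.1 y.1, coordField I₂ (extChartAt I₂ x.2) v.2 y.2) :
        TangentSpace I₁ y.1 × TangentSpace I₂ y.2) := by
  have hy' : y.1 ∈ (chartAt H₁ x.1).source ∧ y.2 ∈ (chartAt H₂ x.2).source := by
    simpa using hy
  have hi := isInvertible_mfderiv_extChartAt (I := I₁.prod I₂) (x := x) (y := y)
    (by rwa [extChartAt_source])
  have hi₁ := isInvertible_mfderiv_extChartAt (I := I₁) (x := x.1) (y := y.1)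
    (by rw [extChartAt_source]; exact hy'.1)
  have hi₂ := isInvertible_mfderiv_extChartAt (I := I₂) (x := x.2) (y := y.2)
    (by rw [extChartAt_source]; exact hy'.2)
  refine coordField_eq hi ?_
  exact (mfderiv_extChartAt_prod hy'.1 hy'.2 _).trans
    (Prod.ext (mfderiv_coordField hi₁ v.1) (mfderiv_coordField hi₂ v.2))

theorem productStructure_coordField {x y : M₁ × M₂}
    (hy : y ∈ (chartAt (ModelProd H₁ H₂) x).source) (v : E₁ × E₂) :
    productStructure y (coordField (I₁.prod I₂) (extChartAt (I₁.prod I₂) x) v y)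
      = coordField (I₁.prod I₂) (extChartAt (I₁.prod I₂) x) (v.1, -v.2) y := by
  have hi := isInvertible_mfderiv_extChartAt (I := I₁.prod I₂) (x := x) (y := y)
    (by rwa [extChartAt_source])
  refine (coordField_eq hi ?_).symm
  rw [mfderiv_extChartAt_productStructure hy, mfderiv_coordField hi]

end ProductCharts

/-! ### The Koszul formula for coordinate fields. -/

section CoordinateKoszul

variable {E : Type*} [NormedAddCommGroup E] [NormedSpace ℝ E]
  {H : Type*} [TopologicalSpace H] {I : ModelWithCorners ℝ E H}
  {M : Type*} [TopologicalSpace M] [ChartedSpace H M] [IsManifold I ∞ M]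

/-- The partial derivative `∂_c ⟨∂_a, ∂_b⟩` of a metric coefficient in the chart `φ`. -/
noncomputable def SmoothMetric.coordDeriv (g : SmoothMetric I M) (φ : M → E) (x : M)
    (a b c : E) : ℝ :=
  d% (fun y ↦ g.inner y (coordField I φ a y) (coordField I φ b y)) x (coordField I φ c x)

variable (g : SmoothMetric I M) (φ : M → E) (x : M)

theorem SmoothMetric.coordDeriv_neg₁ (a b c : E) :
    g.coordDeriv φ x (-a) b c = -g.coordDeriv φ x a b c := by
  have h : (fun y ↦ g.inner y (coordField I φ (-a) y) (coordField I φ b y))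
      = -(fun y ↦ g.inner y (coordField I φ a y) (coordField I φ b y)) := by
    ext y
    simp [coordField_neg]
  rw [coordDeriv, h, mvfderiv_neg]
  rfl

theorem SmoothMetric.coordDeriv_neg₂ (a b c : E) :
    g.coordDeriv φ x a (-b) c = -g.coordDeriv φ x a b c := by
  have h : (fun y ↦ g.inner y (coordField I φ a y) (coordField I φ (-b) y))
      = -(fun y ↦ g.inner y (coordField I φ a y) (coordField I φ b y)) := by
    ext y
    simp [coordField_neg]
  rw [coordDeriv, h, mvfderiv_neg]
  rfl

theorem SmoothMetric.coordDeriv_neg₃ (a b c : E) :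
    g.coordDeriv φ x a b (-c) = -g.coordDeriv φ x a b c := by
  rw [coordDeriv, coordField_neg, map_neg]
  rfl

variable [FiniteDimensional ℝ E] {φ} {x}

/-- The bracket terms vanish, leaving the Christoffel symbols of the first kind. -/
theorem SmoothMetric.koszul_coordField (hφ : CMDiffAt ∞ φ x) (a b c : E) :
    g.koszul (coordField I φ a) (coordField I φ b) (coordField I φ c) x
      = 1 / 2 * (g.coordDeriv φ x b c a + g.coordDeriv φ x c a b - g.coordDeriv φ x a b c) := by
  simp only [koszul, mlieBracket_coordField hφ, map_zero, _root_.zero_apply, coordDeriv]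
  ring

end CoordinateKoszul

/-! ### Parallelism of `F` for the product metric. -/

section ProductConnection

variable {E₁ : Type*} [NormedAddCommGroup E₁] [NormedSpace ℝ E₁] [FiniteDimensional ℝ E₁]
  {H₁ : Type*} [TopologicalSpace H₁] {I₁ : ModelWithCorners ℝ E₁ H₁}
  {M₁ : Type*} [TopologicalSpace M₁] [ChartedSpace H₁ M₁] [IsManifold I₁ ∞ M₁]
  {E₂ : Type*} [NormedAddCommGroup E₂] [NormedSpace ℝ E₂] [FiniteDimensional ℝ E₂]
  {H₂ : Type*} [TopologicalSpace H₂] {I₂ : ModelWithCorners ℝ E₂ H₂}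
  {M₂ : Type*} [TopologicalSpace M₂] [ChartedSpace H₂ M₂] [IsManifold I₂ ∞ M₂]
  (g₁ : SmoothMetric I₁ M₁) (g₂ : SmoothMetric I₂ M₂)

/-- Near `x` a metric coefficient of the product is a function on the first factor plus a function
on the second, so no mixed derivatives appear. -/
theorem SmoothMetric.coordDeriv_prod (x : M₁ × M₂) (a b c : E₁ × E₂) :
    (g₁.prod g₂).coordDeriv (extChartAt (I₁.prod I₂) x) x a b c
      = g₁.coordDeriv (extChartAt I₁ x.1) x.1 a.1 b.1 c.1
        + g₂.coordDeriv (extChartAt I₂ x.2) x.2 a.2 b.2 c.2 := by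
  have hx : x ∈ (chartAt (ModelProd H₁ H₂) x).source := mem_chart_source _ x
  let h₁ : M₁ → ℝ := fun y ↦ g₁.inner y (coordField I₁ (extChartAt I₁ x.1) a.1 y)
    (coordField I₁ (extChartAt I₁ x.1) b.1 y)
  let h₂ : M₂ → ℝ := fun y ↦ g₂.inner y (coordField I₂ (extChartAt I₂ x.2) a.2 y)
    (coordField I₂ (extChartAt I₂ x.2) b.2 y)
  have hd₁ : MDifferentiableAt I₁ 𝓘(ℝ) h₁ x.1 := g₁.mdifferentiableAt
    (mdifferentiableAt_coordField contMDiffAt_extChartAt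
      (isInvertible_mfderiv_extChartAt (mem_extChartAt_source x.1)) a.1)
    (mdifferentiableAt_coordField contMDiffAt_extChartAt
      (isInvertible_mfderiv_extChartAt (mem_extChartAt_source x.1)) b.1)
  have hd₂ : MDifferentiableAt I₂ 𝓘(ℝ) h₂ x.2 := g₂.mdifferentiableAt
    (mdifferentiableAt_coordField contMDiffAt_extChartAt
      (isInvertible_mfderiv_extChartAt (mem_extChartAt_source x.2)) a.2)
    (mdifferentiableAt_coordField contMDiffAt_extChartAt
      (isInvertible_mfderiv_extChartAt (mem_extChartAt_source x.2)) b.2)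
  let L₁ : TangentSpace (I₁.prod I₂) x →L[ℝ] ℝ := (mfderiv I₁ 𝓘(ℝ) h₁ x.1).comp
    (ContinuousLinearMap.fst ℝ (TangentSpace I₁ x.1) (TangentSpace I₂ x.2))
  let L₂ : TangentSpace (I₁.prod I₂) x →L[ℝ] ℝ := (mfderiv I₂ 𝓘(ℝ) h₂ x.2).comp
    (ContinuousLinearMap.snd ℝ (TangentSpace I₁ x.1) (TangentSpace I₂ x.2))
  have hd : HasMFDerivAt (I₁.prod I₂) 𝓘(ℝ) (h₁ ∘ Prod.fst + h₂ ∘ Prod.snd) x (L₁ + L₂) :=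
    (hd₁.hasMFDerivAt.comp x (hasMFDerivAt_fst (I := I₁) (I' := I₂) (x := x))).add
      (hd₂.hasMFDerivAt.comp x (hasMFDerivAt_snd (I := I₁) (I' := I₂) (x := x)))
  have he : (fun y ↦ (g₁.prod g₂).inner y
      (coordField (I₁.prod I₂) (extChartAt (I₁.prod I₂) x) a y)
      (coordField (I₁.prod I₂) (extChartAt (I₁.prod I₂) x) b y))
      =ᶠ[𝓝 x] h₁ ∘ Prod.fst + h₂ ∘ Prod.snd := by
    filter_upwards [(chartAt (ModelProd H₁ H₂) x).open_source.mem_nhds hx] with y hy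
    rw [coordField_prod hy, coordField_prod hy]
    rfl
  have hd' := (hd.congr_of_eventuallyEq he).mfderiv
  have hc := coordField_prod hx c (I₁ := I₁) (I₂ := I₂)
  have h := congrArg (fun L ↦ L (coordField (I₁.prod I₂) (extChartAt (I₁.prod I₂) x) c x)) hd'
  refine Eq.trans h ?_
  rw [hc]
  rfl

/-- The Koszul expression is a sum of one term per factor. Negating the second component of `b` or
that of `c` has the same effect: each summand of the second term changes sign once. -/
theorem SmoothMetric.koszul_productStructure (x : M₁ × M₂) (a b c : E₁ × E₂) :
    (g₁.prod g₂).koszul (coordField (I₁.prod I₂) (extChartAt (I₁.prod I₂) x) a)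
        (coordField (I₁.prod I₂) (extChartAt (I₁.prod I₂) x) (b.1, -b.2))
        (coordField (I₁.prod I₂) (extChartAt (I₁.prod I₂) x) c) x
      = (g₁.prod g₂).koszul (coordField (I₁.prod I₂) (extChartAt (I₁.prod I₂) x) a)
        (coordField (I₁.prod I₂) (extChartAt (I₁.prod I₂) x) b)
        (coordField (I₁.prod I₂) (extChartAt (I₁.prod I₂) x) (c.1, -c.2)) x := by
  rw [koszul_coordField _ contMDiffAt_extChartAt, koszul_coordField _ contMDiffAt_extChartAt]
  simp only [coordDeriv_prod, coordDeriv_neg₁, coordDeriv_neg₂, coordDeriv_neg₃]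

/-- The almost product structure of a product of Riemannian manifolds is parallel. -/
theorem SmoothMetric.leviCivita_productStructure {Y : Π x : M₁ × M₂, TangentSpace (I₁.prod I₂) x}
    {x : M₁ × M₂} (hY : MDiffAt (T% Y) x) (v : TangentSpace (I₁.prod I₂) x) :
    (g₁.prod g₂).leviCivita (fun y ↦ productStructure y (Y y)) x v
      = productStructure x ((g₁.prod g₂).leviCivita Y x v) := by
  let g := g₁.prod g₂
  let φ : M₁ × M₂ → E₁ × E₂ := extChartAt (I₁.prod I₂) x
  have hx : x ∈ (chartAt (ModelProd H₁ H₂) x).source := mem_chart_source _ x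
  have hφ : ContMDiffAt (I₁.prod I₂) 𝓘(ℝ, E₁ × E₂) ∞ φ x := contMDiffAt_extChartAt
  have hi : (mfderiv (I₁.prod I₂) 𝓘(ℝ, E₁ × E₂) φ x).IsInvertible :=
    isInvertible_mfderiv_extChartAt (mem_extChartAt_source x)
  have hX (a : E₁ × E₂) : MDiffAt (T% (coordField (I₁.prod I₂) φ a)) x :=
    mdifferentiableAt_coordField hφ hi a
  have hval (w : TangentSpace (I₁.prod I₂) x) :
      ∃ a : E₁ × E₂, coordField (I₁.prod I₂) φ a x = w :=
    ⟨_, coordField_eq hi rfl⟩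
  -- `Φ Y` is `(∇_v F) Y`. It is tensorial in `Y`, the two Leibniz terms `df(v) F Y` cancelling, so
  -- coordinate fields suffice to show that it vanishes.
  let Φ : (Π x : M₁ × M₂, TangentSpace (I₁.prod I₂) x) → TangentSpace (I₁.prod I₂) x :=
    fun Y ↦ g.leviCivita (fun y ↦ productStructure y (Y y)) x v
      - productStructure x (g.leviCivita Y x v)
  have hcov := g.leviCivita.isCovariantDerivativeOnUniv
  have hΦ : TensorialAt (I₁.prod I₂) (E₁ × E₂) Φ x := by
    constructor
    · intro f σ hf hσ
      have h₁ : (fun y ↦ productStructure y ((f • σ) y))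
          = f • (fun y ↦ productStructure y (σ y)) := by
        ext1 y
        exact map_smul (productStructure y) (f y) (σ y)
      have h₂ : g.leviCivita (f • fun y ↦ productStructure y (σ y)) x v
          = f x • g.leviCivita (fun y ↦ productStructure y (σ y)) x v
            + d% f x v • productStructure x (σ x) :=
        congrArg (fun L ↦ L v) (hcov.leibniz (mdifferentiableAt_productStructure hσ) hf)
      have h₃ : g.leviCivita (f • σ) x v = f x • g.leviCivita σ x v + d% f x v • σ x :=
        congrArg (fun L ↦ L v) (hcov.leibniz hσ hf)
      simp only [Φ]
      rw [h₁, h₂, h₃, map_add, map_smul, map_smul]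
      module
    · intro σ σ' hσ hσ'
      have h₁ : (fun y ↦ productStructure y ((σ + σ') y))
          = (fun y ↦ productStructure y (σ y)) + (fun y ↦ productStructure y (σ' y)) := by
        ext1 y
        exact map_add (productStructure y) (σ y) (σ' y)
      have h₂ : g.leviCivita ((fun y ↦ productStructure y (σ y))
            + fun y ↦ productStructure y (σ' y)) x v
          = g.leviCivita (fun y ↦ productStructure y (σ y)) x v
            + g.leviCivita (fun y ↦ productStructure y (σ' y)) x v :=
        congrArg (fun L ↦ L v) (hcov.add (mdifferentiableAt_productStructure hσ)
          (mdifferentiableAt_productStructure hσ'))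
      have h₃ : g.leviCivita (σ + σ') x v = g.leviCivita σ x v + g.leviCivita σ' x v :=
        congrArg (fun L ↦ L v) (hcov.add hσ hσ')
      simp only [Φ]
      rw [h₁, h₂, h₃, map_add]
      abel
  have hcoord (b : E₁ × E₂) : Φ (coordField (I₁.prod I₂) φ b) = 0 := by
    refine sub_eq_zero.2 (g.ext_inner fun z ↦ ?_)
    -- Extending `v` and `z` by coordinate fields lets the Koszul expression compute both sides; on
    -- the right, `F` is first moved onto `z` by self-adjointness.
    obtain ⟨a, rfl⟩ := hval v
    obtain ⟨c, rfl⟩ := hval z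
    have h₁ : g.leviCivita (fun y ↦ productStructure y (coordField (I₁.prod I₂) φ b y)) x
        = g.leviCivita (coordField (I₁.prod I₂) φ (b.1, -b.2)) x := by
      refine hcov.congr_of_eventuallyEq (mdifferentiableAt_productStructure (hX b)) (hX _)
        Filter.univ_mem ?_
      filter_upwards [(chartAt (ModelProd H₁ H₂) x).open_source.mem_nhds hx] with y hy
      exact productStructure_coordField hy b
    rw [h₁, g.inner_leviCivita (hX a) (hX _) (hX c), inner_productStructure,
      productStructure_coordField hx]
    exact (koszul_productStructure g₁ g₂ x a b c).trans
      (g.inner_leviCivita (hX a) (hX b) (hX _)).symm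
  obtain ⟨b, hb⟩ := hval (Y x)
  have hF : Φ Y = 0 := (hΦ.pointwise hY (hX b) hb.symm).trans (hcoord b)
  exact sub_eq_zero.1 hF

end ProductConnection

/-! ### Ambient coordinates adapted to an immersion. -/

section Immersion

variable {E : Type*} [NormedAddCommGroup E] [NormedSpace ℝ E]
  {H : Type*} [TopologicalSpace H] {I : ModelWithCorners ℝ E H} [I.Boundaryless]
  {M : Type*} [TopologicalSpace M] [ChartedSpace H M] [IsManifold I ∞ M]
  {E' : Type*} [NormedAddCommGroup E'] [NormedSpace ℝ E']
  {H' : Type*} [TopologicalSpace H'] {I' : ModelWithCorners ℝ E' H'} [I'.Boundaryless]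
  {N : Type*} [TopologicalSpace N] [ChartedSpace H' N] [IsManifold I' ∞ N]

/-- Near a point of an immersed submanifold there are adapted coordinates of the ambient manifold,
in which the vectors with constant coordinates in the range of `L` span the tangent spaces of the
submanifold. -/
theorem exists_adapted_coordinates {ι : M → N} {p : M} (hι : IsImmersionAt I I' ∞ ι p) :
    ∃ (φ : N → E') (L : E →L[ℝ] E'), ContMDiffAt I' 𝓘(ℝ, E') ∞ φ (ι p) ∧
      (mfderiv I' 𝓘(ℝ, E') φ (ι p)).IsInvertible ∧
      (∀ u, IsTangentNear I I' ι p (coordField I' φ (L u))) ∧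
      ∀ X ∈ tangentSub I I' ι p, ∃ u, coordField I' φ (L u) (ι p) = X := by
  obtain ⟨F, _, _, h⟩ := hι
  let ψ := h.domChart.extend I
  let φ := h.codChart.extend I'
  -- In the charts of the immersion normal form, `ι` is `u ↦ h.equiv (u, 0)`, which is this linear
  -- map.
  let L : E →L[ℝ] E' :=
    (h.equiv : (E × F) →L[ℝ] E').comp (ContinuousLinearMap.inl ℝ E F)
  have hsrc : h.domChart.source ∈ 𝓝 p := h.domChart.open_source.mem_nhds h.mem_domChart_source
  have hφi {q : M} (hq : q ∈ h.domChart.source) :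
      (mfderiv I' 𝓘(ℝ, E') φ (ι q)).IsInvertible :=
    isInvertible_mfderiv_extend h.codChart_mem_maximalAtlas (h.source_subset_preimage_source hq)
  have hψi {q : M} (hq : q ∈ h.domChart.source) : (mfderiv I 𝓘(ℝ, E) ψ q).IsInvertible :=
    isInvertible_mfderiv_extend h.domChart_mem_maximalAtlas hq
  have hd {q : M} (hq : q ∈ h.domChart.source) : MDifferentiableAt I I' ι q :=
    (h.contMDiffOn.contMDiffAt (h.domChart.open_source.mem_nhds hq)).mdifferentiableAt (by simp)
  -- The derivative of the identity `φ ∘ ι = L ∘ ψ`, valid near each `q` of the chart domain.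
  have key {q : M} (hq : q ∈ h.domChart.source) (X : TangentSpace I q) :
      mfderiv I' 𝓘(ℝ, E') φ (ι q) (mfderiv I I' ι q X) = L (mfderiv I 𝓘(ℝ, E) ψ q X) := by
    have hφd : MDifferentiableAt I' 𝓘(ℝ, E') φ (ι q) :=
      (h.codChart.contMDiffAt_extend h.codChart_mem_maximalAtlas
        (h.source_subset_preimage_source hq)).mdifferentiableAt (by simp)
    have hψd : MDifferentiableAt I 𝓘(ℝ, E) ψ q :=
      (h.domChart.contMDiffAt_extend h.domChart_mem_maximalAtlas hq).mdifferentiableAt (by simp)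
    have h1 := hφd.hasMFDerivAt.comp q (hd hq).hasMFDerivAt
    have h2 := (L.hasMFDerivAt (x := ψ q)).comp q hψd.hasMFDerivAt
    have he : φ ∘ ι =ᶠ[𝓝 q] L ∘ ψ := by
      filter_upwards [h.domChart.open_source.mem_nhds hq] with y hy
      have hy' : y ∈ ψ.source := by rwa [h.domChart.extend_source]
      have := h.writtenInCharts (ψ.map_source hy')
      simp only [Function.comp_apply] at this
      rw [show (h.domChart.extend I).symm (ψ y) = y from ψ.left_inv hy'] at this
      exact this
    exact congrArg (fun A ↦ A X) (hasMFDerivAt_unique h1 (h2.congr_of_eventuallyEq he))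
  refine ⟨φ, L, h.codChart.contMDiffAt_extend h.codChart_mem_maximalAtlas h.mem_codChart_source,
    hφi h.mem_domChart_source, fun u ↦ ?_, ?_⟩
  · filter_upwards [hsrc] with q hq
    -- The preimage is the coordinate vector of `M` at `q` with components `u`, which `key` sends to
    -- the ambient one with components `L u`.
    refine ⟨(mfderiv I 𝓘(ℝ, E) ψ q).inverse u, (coordField_eq (hφi hq) ?_).symm⟩
    exact (key hq _).trans (congrArg L (mfderiv_coordField (hψi hq) u))
  · rintro _ ⟨X, rfl⟩
    exact ⟨_, coordField_eq (hφi h.mem_domChart_source) (key h.mem_domChart_source X)⟩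

end Immersion

/-! ### Anti-invariant submanifolds of the product. -/

section AntiInvariant

variable {E : Type*} [NormedAddCommGroup E] [NormedSpace ℝ E]
  {H : Type*} [TopologicalSpace H] {I : ModelWithCorners ℝ E H}
  {M : Type*} [TopologicalSpace M] [ChartedSpace H M]
  {E₁ : Type*} [NormedAddCommGroup E₁] [NormedSpace ℝ E₁] [FiniteDimensional ℝ E₁]
  {H₁ : Type*} [TopologicalSpace H₁] {I₁ : ModelWithCorners ℝ E₁ H₁}
  {M₁ : Type*} [TopologicalSpace M₁] [ChartedSpace H₁ M₁] [IsManifold I₁ ∞ M₁]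
  {E₂ : Type*} [NormedAddCommGroup E₂] [NormedSpace ℝ E₂] [FiniteDimensional ℝ E₂]
  {H₂ : Type*} [TopologicalSpace H₂] {I₂ : ModelWithCorners ℝ E₂ H₂}
  {M₂ : Type*} [TopologicalSpace M₂] [ChartedSpace H₂ M₂] [IsManifold I₂ ∞ M₂]
  {g₁ : SmoothMetric I₁ M₁} {g₂ : SmoothMetric I₂ M₂} {ι : M → M₁ × M₂} {p : M}

/-- For an `F`-anti-invariant submanifold, `⟨∇_X Y, F Z⟩` is antisymmetric in the tangent vector
fields `Y` and `Z`. -/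
theorem IsFAntiInvariant.inner_leviCivita_antisymm
    (hF : IsFAntiInvariant I (g₁.prod g₂) ι) (hι : MDifferentiableAt I (I₁.prod I₂) ι p)
    {Y Z : Π y : M₁ × M₂, TangentSpace (I₁.prod I₂) y}
    (hY : MDiffAt (T% Y) (ι p)) (hZ : MDiffAt (T% Z) (ι p))
    (hYt : IsTangentNear I (I₁.prod I₂) ι p Y) (hZt : IsTangentNear I (I₁.prod I₂) ι p Z)
    {X : TangentSpace (I₁.prod I₂) (ι p)} (hX : X ∈ tangentSub I (I₁.prod I₂) ι p) :
    (g₁.prod g₂).inner (ι p) ((g₁.prod g₂).leviCivita Y (ι p) X) (productStructure (ι p) (Z (ι p)))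
      = -(g₁.prod g₂).inner (ι p) ((g₁.prod g₂).leviCivita Z (ι p) X)
        (productStructure (ι p) (Y (ι p))) := by
  let g := g₁.prod g₂
  let f : M₁ × M₂ → ℝ := fun y ↦ g.inner y (Y y) (productStructure y (Z y))
  have hFZ := mdifferentiableAt_productStructure hZ
  have hf : MDifferentiableAt (I₁.prod I₂) 𝓘(ℝ) f (ι p) := g.mdifferentiableAt hY hFZ
  have hzero : d% f (ι p) X = 0 := by
    obtain ⟨x, rfl⟩ := hX
    -- The function `f` vanishes only along `M`, so its derivative is known only in tangent
    -- directions, through `f ∘ ι`.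
    have h0 : f ∘ ι =ᶠ[𝓝 p] fun _ ↦ (0 : ℝ) := by
      filter_upwards [hYt, hZt] with q hq hq'
      exact (g.symm _ _ _).trans (hF q _ hq' _ hq)
    have h1 := hasMFDerivAt_unique (hf.hasMFDerivAt.comp p hι.hasMFDerivAt)
      ((hasMFDerivAt_const (0 : ℝ) p).congr_of_eventuallyEq h0)
    exact congrArg (fun A ↦ A x) h1
  have hext := FiberBundle.mdifferentiableAt_extend (I₁.prod I₂) (E₁ × E₂) X
  have hm := g.leviCivita_metric hext hY hFZ
  rw [FiberBundle.extend_apply_self, SmoothMetric.leviCivita_productStructure g₁ g₂ hZ] at hm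
  -- As `F` is parallel, the second term of the metric identity contains `F (∇_X Z)`;
  -- self-adjointness moves `F` onto `Y`.
  have hswap : g.inner (ι p) (Y (ι p)) (productStructure (ι p) (g.leviCivita Z (ι p) X))
      = g.inner (ι p) (g.leviCivita Z (ι p) X) (productStructure (ι p) (Y (ι p))) :=
    (g.symm _ _ _).trans (inner_productStructure g₁ g₂ _ _ _)
  exact eq_neg_of_add_eq_zero_left
    ((congrArg (_ + ·) hswap.symm).trans (hm.symm.trans hzero))

/-- For an `F`-anti-invariant immersed submanifold, the component of `∇_X Y` along `F Z` vanishes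
for all tangent `X`, `Y`, `Z`. -/
theorem IsFAntiInvariant.inner_leviCivita_productStructure_eq_zero
    [I.Boundaryless] [IsManifold I ∞ M] [I₁.Boundaryless] [I₂.Boundaryless]
    (hF : IsFAntiInvariant I (g₁.prod g₂) ι) (hι : IsImmersionAt I (I₁.prod I₂) ∞ ι p)
    {Y : Π y : M₁ × M₂, TangentSpace (I₁.prod I₂) y} (hY : MDiffAt (T% Y) (ι p))
    (hYt : IsTangentNear I (I₁.prod I₂) ι p Y) {X Z : TangentSpace (I₁.prod I₂) (ι p)}
    (hX : X ∈ tangentSub I (I₁.prod I₂) ι p) (hZ : Z ∈ tangentSub I (I₁.prod I₂) ι p) :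
    (g₁.prod g₂).inner (ι p) ((g₁.prod g₂).leviCivita Y (ι p) X)
      (productStructure (ι p) Z) = 0 := by
  have hd : MDifferentiableAt I (I₁.prod I₂) ι p := hι.contMDiffAt.mdifferentiableAt (by simp)
  obtain ⟨φ, L, hφ, hi, htan, hspan⟩ := exists_adapted_coordinates hι
  let g := g₁.prod g₂
  let A (u : E) := coordField (I₁.prod I₂) φ (L u)
  have hA (u : E) : MDiffAt (T% (A u)) (ι p) := mdifferentiableAt_coordField hφ hi (L u)
  let α (u v w : E) : ℝ := g.inner (ι p) (g.leviCivita (A v) (ι p) (A u (ι p)))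
    (productStructure (ι p) (A w (ι p)))
  -- The adapted fields are coordinate fields, so their bracket vanishes and zero torsion gives `∇_u
  -- A_v = ∇_v A_u`.
  have hsymm (u v w : E) : α u v w = α v u w := by
    have h := g.leviCivita_torsion_free (hA u) (hA v)
    rw [show mlieBracket (I₁.prod I₂) (A u) (A v) (ι p) = 0 from mlieBracket_coordField hφ _ _,
      sub_eq_zero] at h
    simp only [α, h]
  have hanti (u v w : E) : α u v w = -α u w v :=
    hF.inner_leviCivita_antisymm hd (hA v) (hA w) (htan v) (htan w) (htan u).self_of_nhds
  have hα (u v w : E) : α u v w = 0 := by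
    -- Alternating the two symmetries gives `α u v w = α v u w = -α v w u = -α w v u = α w u v = α u
    -- w v = -α u v w`.
    linarith [hsymm u v w, hanti v u w, hsymm v w u, hanti w v u, hsymm w u v, hanti u w v]
  obtain ⟨u, rfl⟩ := hspan X hX
  obtain ⟨w, rfl⟩ := hspan Z hZ
  obtain ⟨v, hv⟩ := hspan (Y (ι p)) hYt.self_of_nhds
  -- The field `Y` need not be a coordinate field. Antisymmetry moves the derivative from `Y` to `A
  -- w`, after which only the value of `Y` at `ι p` enters, and this equals that of `A v`.
  refine (hF.inner_leviCivita_antisymm hd hY (hA w) hYt (htan w) hX).trans ?_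
  rw [← hv]
  exact neg_eq_zero.2 (hα u w v)

/-- An `F`-anti-invariant immersed submanifold of a product of Riemannian manifolds with `s = 0`
is totally geodesic. -/
theorem IsFAntiInvariant.isTotallyGeodesic
    [I.Boundaryless] [IsManifold I ∞ M] [I₁.Boundaryless] [I₂.Boundaryless]
    (hF : IsFAntiInvariant I (g₁.prod g₂) ι) (hι : ∀ p, IsImmersionAt I (I₁.prod I₂) ∞ ι p)
    (hs : ∀ p, sOperator I (g₁.prod g₂) ι p = 0) :
    IsTotallyGeodesic I (g₁.prod g₂) ι := by
  intro p X Y hY hYt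
  let g := g₁.prod g₂
  let D := g.leviCivita Y (ι p) (mfderiv I (I₁.prod I₂) ι p X)
  let B := normalPart I g ι p D
  have hB : B ∈ normalSub I g ι p := Submodule.projection_apply_mem _ D
  have hsB : normalPart I g ι p (productStructure (ι p) B) = 0 :=
    LinearMap.congr_fun (hs p) ⟨B, hB⟩
  have ht (v : TangentSpace (I₁.prod I₂) (ι p)) :
      tangentialPart I g ι p v ∈ tangentSub I (I₁.prod I₂) ι p :=
    Submodule.projection_apply_mem _ v
  -- The condition `s = 0` leaves `F B` with only its tangential part.
  have hFB : productStructure (ι p) B ∈ tangentSub I (I₁.prod I₂) ι p := by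
    have h := tangentialPart_add_normalPart I g ι p (productStructure (ι p) B)
    rw [hsB, add_zero] at h
    exact h ▸ ht _
  -- With `Z = F B` one has `F Z = B`, so `∇_X Y` is orthogonal to its own normal part.
  have h0 := hF.inner_leviCivita_productStructure_eq_zero (hι p)
    (hY.mdifferentiableAt (by simp)) hYt ⟨X, rfl⟩ hFB
  rw [productStructure_productStructure] at h0
  have h1 : g.inner (ι p) (tangentialPart I g ι p D + B) B = 0 := by
    rw [tangentialPart_add_normalPart]
    exact h0
  rw [map_add, _root_.add_apply, g.symm, hB _ (ht D), zero_add] at h1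
  by_contra hne
  exact (g.pos (ι p) B hne).ne' h1

end AntiInvariant

end KaehlerProduct

theorem theorem4p1
    {E₁ : Type*} [NormedAddCommGroup E₁] [NormedSpace ℝ E₁] [FiniteDimensional ℝ E₁]
    {M₁ : Type*} [TopologicalSpace M₁] [ChartedSpace E₁ M₁] [IsManifold 𝓘(ℝ, E₁) ∞ M₁]
    {E₂ : Type*} [NormedAddCommGroup E₂] [NormedSpace ℝ E₂] [FiniteDimensional ℝ E₂]
    {M₂ : Type*} [TopologicalSpace M₂] [ChartedSpace E₂ M₂] [IsManifold 𝓘(ℝ, E₂) ∞ M₂]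
    (K₁ : KaehlerProduct.KaehlerStructure E₁ M₁) (K₂ : KaehlerProduct.KaehlerStructure E₂ M₂)
    {E : Type*} [NormedAddCommGroup E] [NormedSpace ℝ E] [FiniteDimensional ℝ E]
    {M : Type*} [TopologicalSpace M] [ChartedSpace E M] [IsManifold 𝓘(ℝ, E) ∞ M]
    (ι : M → M₁ × M₂)
    (hι : IsImmersion 𝓘(ℝ, E) (𝓘(ℝ, E₁).prod 𝓘(ℝ, E₂)) ∞ ι)
    (hF : KaehlerProduct.IsFAntiInvariant 𝓘(ℝ, E) (K₁.metric.prod K₂.metric) ι)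
    (hs : ∀ p : M, KaehlerProduct.sOperator 𝓘(ℝ, E) (K₁.metric.prod K₂.metric) ι p = 0) :
    KaehlerProduct.IsTotallyGeodesic 𝓘(ℝ, E) (K₁.metric.prod K₂.metric) ι :=
  hF.isTotallyGeodesic (fun p ↦ hι.isImmersionAt p) hs
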